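/- **Convergence rate of the block-global block conjugate gradient (BCG) method.** Let $p,q\ge 1$, $s=pq$ and $r=\lceil p/q\rceil$. Write $X\in\mathbb R^{n\times s}$ column-wise as $X=[X_1,\dots,X_q]$ with $X_j\in\mathbb R^{n\times p}$, let $\mathbb S=\mathbb S_{BG}^p=I_q\otimes\mathbb R^{p\times p}\subset\mathbb R^{s\times s}$ and $\langle X,Y\rangle_{\mathbb S}=\frac1q\sum_{j=1}^q I_q\otimes X_j^\top Y_j$. For a square matrix $T$ and a block vector $R$ put $\mathcal K^k_{\mathbb S}(T,R)=\{\sum_{i=0}^{k-1}T^iRc_i : c_0,\dots,c_{k-1}\in\mathbb S\}$. Let $\|x\|_A=\sqrt{x^\top Ax}$ and $\|X\|_{A,F}=\sqrt{\operatorname{tr}(X^\top AX)}$. There is a function $C:\mathbb R^3\to(0,\infty)$, depending only on $p$ and $q$, such that the following holds for every $n\ge r$, all symmetric positive definite $A,M\in\mathbb R^{n\times n}$ and all $B,X^0\in\mathbb R^{n\times s}$. Let $\lambda_1\le\dots\le\lambda_n$ be the eigenvalues of $M^{-1/2}AM^{-1/2}$, counted with multiplicity, and, if $r>1$, assume $\lambda_r<\lambda_n$.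 Put $$\hat\kappa_p=\frac{\lambda_n}{\lambda_{\lceil p/q\rceil}},\qquad \hat\mu=\frac{\sqrt{\hat\kappa_p}-1}{\sqrt{\hat\kappa_p}+1},\qquad X^*=A^{-1}B,\quad R^0=B-AX^0,\quad c_1=C(\lambda_1,\lambda_r,\lambda_n)\,\|X^*-X^0\|_{A,F}.$$ 1. For every $k\ge0$ there is exactly one $X^k$ that minimizes $\|Y-X^*\|_{A,F}$ over $Y\in X^0+\mathcal K^k_{\mathbb S}(M^{-1}A,M^{-1}R^0)$ (the $k$-th iterate of the block-global BCG method), and every column $E^k_i$ ($1\le i\le s$) of its error $E^k=X^*-X^k$ satisfies $$\|E^k_i\|_A\le c_1\,\hat\mu^{\,k}.$$ 2. The same bound holds for the $k$-th approximation $X^k$ computed by the BCG algorithm $P^0=M^{-1}R^0$, $\alpha^k=\langle P^k,AP^k\rangle_{\mathbb S}$, $\rho^k=\langle M^{-1}R^k,R^k\rangle_{\mathbb S}$, $\lambda^k=(\alpha^k)^{-1}\rho^k$, $X^{k+1}=X^k+P^k\lambda^k$, $R^{k+1}=R^k-AP^k\lambda^k$, $\beta^k=(\rho^k)^{-1}\rho^{k+1}$,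 $P^{k+1}=M^{-1}R^{k+1}+P^k\beta^k$, for every $k$ such that $\alpha^j$ and $\rho^j$ are invertible for all $j<k$. (The coefficients $\lambda^k\in\mathbb S$ carry an upper index and are not the eigenvalues $\lambda_j$.) In particular $c_1$ does not depend on $k$ or $i$. (The convention $0^0=1$ is used.) -/

import Mathlib

open scoped Kronecker MatrixOrder

namespace BlockKrylov

/-- A block vector with `s = q * p` real columns.  The columns are indexed by `Fin q × Fin p`: column
`(j, l)` is the `l`-th column of the `j`-th `n × p` slice, i.e. `X = [X_1, …, X_q]`. -/
abbrev BlockVec (n q p : ℕ) := Matrix (Fin n) (Fin q × Fin p) ℝ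

/-- The coefficient matrices, `ℝ^(s × s)` with `s = q * p`. -/
abbrev Coeff (q p : ℕ) := Matrix (Fin q × Fin p) (Fin q × Fin p) ℝ

/-- The `j`-th slice `X_j ∈ ℝ^(n × p)` of `X = [X_1, …, X_q]`. -/
def slice {n q p : ℕ} (X : BlockVec n q p) (j : Fin q) : Matrix (Fin n) (Fin p) ℝ :=
  X.submatrix id (fun l => (j, l))

/-- The block-global `*`-subalgebra `I_q ⊗ ℝ^(p × p)` of `ℝ^(s × s)`. -/
def blockGlobal (q p : ℕ) : StarSubalgebra ℝ (Coeff q p) where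
  carrier := {σ | ∃ γ : Matrix (Fin p) (Fin p) ℝ, σ = (1 : Matrix (Fin q) (Fin q) ℝ) ⊗ₖ γ}
  mul_mem' := by
    rintro _ _ ⟨γ, rfl⟩ ⟨δ, rfl⟩
    exact ⟨γ * δ, by rw [← Matrix.mul_kronecker_mul, one_mul]⟩
  add_mem' := by
    rintro _ _ ⟨γ, rfl⟩ ⟨δ, rfl⟩
    exact ⟨γ + δ, by rw [Matrix.kronecker_add]⟩
  algebraMap_mem' := by
    intro r
    refine ⟨r • 1, ?_⟩
    rw [Matrix.kronecker_smul, Matrix.one_kronecker_one, Algebra.algebraMap_eq_smul_one]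
  star_mem' := by
    rintro _ ⟨γ, rfl⟩
    refine ⟨γ.conjTranspose, ?_⟩
    rw [Matrix.star_eq_conjTranspose, Matrix.conjTranspose_kronecker, Matrix.conjTranspose_one]

/-- The block-global block inner product `⟨X, Y⟩ = (1/q) ∑_j I_q ⊗ (X_jᵀ Y_j)`. -/
noncomputable def blockInner {n q p : ℕ} (X Y : BlockVec n q p) : Coeff q p :=
  (1 / (q : ℝ)) • ∑ j : Fin q,
    (1 : Matrix (Fin q) (Fin q) ℝ) ⊗ₖ ((slice X j).transpose * slice Y j)

/-- The `k`-th block Krylov space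
`K_S^k(A, R) = {∑_{i < k} A^i R c_i | c_0, …, c_{k-1} ∈ S}`. -/
def krylov {n q p : ℕ} (S : StarSubalgebra ℝ (Coeff q p)) (A : Matrix (Fin n) (Fin n) ℝ)
    (R : BlockVec n q p) (k : ℕ) : Set (BlockVec n q p) :=
  {Y | ∃ c : ℕ → Coeff q p, (∀ i, c i ∈ S) ∧ Y = ∑ i ∈ Finset.range k, A ^ i * R * c i}

/-- The energy norm `‖x‖_A = √(xᵀ A x)`. -/
noncomputable def energyNorm {n : ℕ} (A : Matrix (Fin n) (Fin n) ℝ) (x : Fin n → ℝ) : ℝ :=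
  Real.sqrt (dotProduct x (A.mulVec x))

/-- The block energy norm `‖X‖_{A,F} = √(tr(Xᵀ A X))`. -/
noncomputable def blockEnergyNorm {n q p : ℕ} (A : Matrix (Fin n) (Fin n) ℝ)
    (X : BlockVec n q p) : ℝ :=
  Real.sqrt (X.transpose * A * X).trace

/-- `Y` is the `k`-th approximation of the block conjugate gradient method over `S` with
preconditioner `M`, for the system `A X = B` with initial guess `X0`:  `Y` lies in
`X0 + K_S^k(M⁻¹ A, M⁻¹ R0)`, `R0 = B - A X0`, and it minimizes the block energy error
`‖Y - A⁻¹ B‖_{A,F}` there. -/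
def IsBCGIterate {n q p : ℕ} (S : StarSubalgebra ℝ (Coeff q p)) (A M : Matrix (Fin n) (Fin n) ℝ)
    (B X0 : BlockVec n q p) (k : ℕ) (Y : BlockVec n q p) : Prop :=
  IsMinOn (fun Z => blockEnergyNorm A (Z - A⁻¹ * B))
      {Z | Z - X0 ∈ krylov S (M⁻¹ * A) (M⁻¹ * (B - A * X0)) k} Y ∧
    Y - X0 ∈ krylov S (M⁻¹ * A) (M⁻¹ * (B - A * X0)) k

/-- The variables `X^k, R^k, P^k` of the block conjugate gradient algorithm. -/
structure BCGState (n q p : ℕ) where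
  /-- the approximation `X^k` -/
  X : BlockVec n q p
  /-- the residual `R^k` -/
  R : BlockVec n q p
  /-- the search direction `P^k` -/
  P : BlockVec n q p

/-- `α^k = ⟨P^k, A P^k⟩` -/
noncomputable def BCGState.alpha {n q p : ℕ} (A : Matrix (Fin n) (Fin n) ℝ)
    (st : BCGState n q p) : Coeff q p :=
  blockInner st.P (A * st.P)

/-- `ρ^k = ⟨M⁻¹ R^k, R^k⟩` -/
noncomputable def BCGState.rho {n q p : ℕ} (M : Matrix (Fin n) (Fin n) ℝ)
    (st : BCGState n q p) : Coeff q p :=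
  blockInner (M⁻¹ * st.R) st.R

/-- The run of the block-global block conjugate gradient algorithm, without stopping criterion:
`R^0 = B - A X^0`, `P^0 = M⁻¹ R^0`, and with `λ^k = (α^k)⁻¹ ρ^k`, `β^k = (ρ^k)⁻¹ ρ^(k+1)`,
`X^(k+1) = X^k + P^k λ^k`, `R^(k+1) = R^k - A P^k λ^k`, `P^(k+1) = M⁻¹ R^(k+1) + P^k β^k`.
It is meaningful as long as the matrices that are inverted are invertible. -/
noncomputable def bcgRun {n q p : ℕ} (A M : Matrix (Fin n) (Fin n) ℝ) (B X0 : BlockVec n q p) :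
    ℕ → BCGState n q p
  | 0 => { X := X0, R := B - A * X0, P := M⁻¹ * (B - A * X0) }
  | k + 1 =>
    let st := bcgRun A M B X0 k
    let lam := (st.alpha A)⁻¹ * st.rho M
    let R' := st.R - A * st.P * lam
    let beta := (st.rho M)⁻¹ * blockInner (M⁻¹ * R') R'
    { X := st.X + st.P * lam
      R := R'
      P := M⁻¹ * R' + st.P * beta }

/-- The symmetrically preconditioned operator `M^(-1/2) A M^(-1/2)`. -/
noncomputable def precond {n : ℕ} (A M : Matrix (Fin n) (Fin n) ℝ) : Matrix (Fin n) (Fin n) ℝ :=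
  (CFC.sqrt M)⁻¹ * A * (CFC.sqrt M)⁻¹

/-- `ev 1 ≤ ev 2 ≤ … ≤ ev n` are the eigenvalues of the `n × n` matrix `T`, listed with their
multiplicities (values of `ev` outside `1, …, n` are irrelevant). -/
def IsOrderedSpectrum {n : ℕ} (T : Matrix (Fin n) (Fin n) ℝ) (ev : ℕ → ℝ) : Prop :=
  MonotoneOn ev (Set.Icc 1 n) ∧
    T.charpoly = ∏ j ∈ Finset.Icc 1 n, (Polynomial.X - Polynomial.C (ev j))

/-- The convergence rate `(√κ - 1) / (√κ + 1)`. -/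
noncomputable def cgRate (κ : ℝ) : ℝ := (Real.sqrt κ - 1) / (Real.sqrt κ + 1)

end BlockKrylov

open BlockKrylov

/-!
The energy error of an iterate is at most that of any competitor in the affine Krylov space, and
scalar polynomials already supply good competitors.  If `f` has degree at most `k` and `f 0 = 1`,
then `f (M⁻¹ A) (X* - X⁰)` is the error of such a competitor (`sub_aeval_mul_mem_krylov`), because
scalar matrices belong to every coefficient algebra.  Since `M⁻¹ A` is similar, through `M^(1/2)`,
to the symmetric matrix `M^(-1/2) A M^(-1/2)`, the energy norm of this error is at most
`max |f (λ_j)|` times the initial one (`blockEnergyNorm_aeval_mul_le`).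

It remains to choose `f` (`exists_deflated_polynomial`).  The linear factors `1 - x / λ_j`, `j < r`,
annihilate the `r - 1` smallest eigenvalues and are bounded by `λ_n / λ_1` on the others; the
remaining `k - (r - 1)` degrees go to the Chebyshev polynomial of `[λ_r, λ_n]`, normalized at `0`,
which is at most `2 μ ^ (k - (r - 1))` there (`exists_chebyshev_bound`).  As `μ > 0` if `r > 1`, the
missing power of `μ` is absorbed by the constant, and so are the finitely many `k < r - 1`.  A
column of the error is bounded by the whole block (`energyNorm_col_le`).

Existence and uniqueness of the minimizer come from the orthogonal projection in the energy inner
product; the Galerkin condition characterizes the minimizer (`isBCGIterate_of_orthogonal`).  For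
the algorithm, the classical orthogonality relations hold for the matrix-valued inner product
(`bcgRun_orthogonality`), and the search directions generate the Krylov space as long as the step
lengths are invertible (`krylov_le_directionSpan`).  Hence the Galerkin condition holds, the
computed approximation is the minimizer (`isBCGIterate_bcgRun`), and it inherits the bound.
-/

namespace BlockKrylov

/-! ### Residual polynomials -/

section Polynomials

open Polynomial

lemma cgRate_div {a b : ℝ} (ha : 0 < a) (hb : 0 < b) :
    cgRate (b / a) = (√b - √a) / (√b + √a) := by
  have h1 := Real.sqrt_pos.2 ha
  have h2 := Real.sqrt_pos.2 hb
  rw [cgRate, Real.sqrt_div' b ha.le]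
  field_simp

lemma cgRate_nonneg {a b : ℝ} (ha : 0 < a) (hab : a ≤ b) : 0 ≤ cgRate (b / a) := by
  rw [cgRate_div ha (ha.trans_le hab)]
  exact div_nonneg (sub_nonneg.2 (Real.sqrt_le_sqrt hab)) (by positivity)

lemma cgRate_pos {a b : ℝ} (ha : 0 < a) (hab : a < b) : 0 < cgRate (b / a) := by
  rw [cgRate_div ha (ha.trans hab)]
  have h1 := Real.sqrt_pos.2 ha
  have h2 := Real.sqrt_lt_sqrt ha.le hab
  exact div_pos (by linarith) (by linarith)

lemma cgRate_le_one {a b : ℝ} (ha : 0 < a) (hab : a ≤ b) : cgRate (b / a) ≤ 1 := by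
  rw [cgRate_div ha (ha.trans_le hab)]
  have h1 := Real.sqrt_pos.2 ha
  have h2 := Real.sqrt_le_sqrt hab
  rw [div_le_one (by linarith)]
  linarith

/-- The value of the Chebyshev polynomial at a point of the Joukowski form `(z + z⁻¹) / 2`. -/
lemma eval_T_joukowski {z : ℝ} (hz : z ≠ 0) (m : ℕ) :
    (Chebyshev.T ℝ m).eval ((z + z⁻¹) / 2) = (z ^ m + z⁻¹ ^ m) / 2 := by
  induction m using Nat.twoStepInduction with
  | zero => simp
  | one => simp
  | more m h0 h1 =>
    have h : ((m + 2 : ℕ) : ℤ) = (m : ℤ) + 2 := by push_cast; ring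
    rw [h, Chebyshev.T_add_two]
    push_cast at h1
    simp only [eval_sub, eval_mul, eval_ofNat, eval_X, h0, h1, inv_pow]
    field_simp
    ring

lemma abs_eval_T_le_one {x : ℝ} (h1 : -1 ≤ x) (h2 : x ≤ 1) (m : ℤ) :
    |(Chebyshev.T ℝ m).eval x| ≤ 1 := by
  rw [← Real.cos_arccos h1 h2, Chebyshev.T_real_cos]
  exact Real.abs_cos_le_one _

/-- The rescaled Chebyshev polynomial on `[a, b]`, normalized at `0`.  The number `0` is mapped to
the Joukowski image of the reciprocal of the convergence rate. -/
lemma exists_chebyshev_bound {a b : ℝ} (ha : 0 < a) (hab : a ≤ b) (m : ℕ) :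
    ∃ f : ℝ[X], f.natDegree ≤ m ∧ f.eval 0 = 1 ∧
      ∀ x, a ≤ x → x ≤ b → |f.eval x| ≤ 2 * cgRate (b / a) ^ m := by
  have hb : 0 < b := ha.trans_le hab
  rcases hab.eq_or_lt with rfl | hlt
  · -- the interval is a point, the rate vanishes, and `0 ^ 0 = 1`
    refine ⟨(1 - C a⁻¹ * X) ^ m, ?_, by simp, fun x h1 h2 => ?_⟩
    · refine natDegree_pow_le.trans ?_
      have : (1 - C a⁻¹ * X : ℝ[X]).natDegree ≤ 1 := by compute_degree
      nlinarith
    · obtain rfl : x = a := le_antisymm h2 h1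
      have h0 : cgRate (x / x) = 0 := by rw [cgRate_div ha ha]; simp
      rw [h0]
      rcases m with _ | m
      · simp
      · simp [ha.ne']
  · set μ := cgRate (b / a) with hμ
    have hμ0 : 0 < μ := cgRate_pos ha hlt
    set t : ℝ := (Chebyshev.T ℝ m).eval ((μ + μ⁻¹) / 2) with ht
    have htv := eval_T_joukowski hμ0.ne' m
    rw [← ht] at htv
    have ht0 : 0 < t := by rw [htv]; positivity
    have hba : 0 < b - a := sub_pos.2 hlt
    have hz : (b + a) / (b - a) = (μ + μ⁻¹) / 2 := by
      rw [hμ, cgRate_div ha hb, inv_div]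
      have h1 := Real.sqrt_pos.2 ha
      have h2 := Real.sqrt_lt_sqrt ha.le hlt
      have h3 : √b - √a ≠ 0 := by linarith
      have h4 : √b + √a ≠ 0 := by linarith
      have h5 : b - a = (√b - √a) * (√b + √a) := by
        nlinarith [Real.sq_sqrt ha.le, Real.sq_sqrt hb.le]
      have h6 : b + a = √b ^ 2 + √a ^ 2 := by rw [Real.sq_sqrt ha.le, Real.sq_sqrt hb.le]
      rw [h5, h6]
      field_simp
      ring
    refine ⟨C t⁻¹ * (Chebyshev.T ℝ m).comp (C ((b + a) / (b - a)) - C (2 / (b - a)) * X),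
      ?_, ?_, fun x h1 h2 => ?_⟩
    · refine (natDegree_C_mul_le _ _).trans (natDegree_comp_le.trans ?_)
      have hd : (C ((b + a) / (b - a)) - C (2 / (b - a)) * X : ℝ[X]).natDegree ≤ 1 := by
        compute_degree
      have hT : (Chebyshev.T ℝ m).natDegree ≤ m := by
        simp
      nlinarith
    · simp only [eval_mul, eval_C, eval_comp, eval_sub, eval_X, mul_zero, sub_zero, hz, ← ht]
      exact inv_mul_cancel₀ ht0.ne'
    · simp only [eval_mul, eval_C, eval_comp, eval_sub, eval_X]
      rw [abs_mul, abs_inv, abs_of_pos ht0]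
      have hx : (b + a) / (b - a) - 2 / (b - a) * x = (b + a - 2 * x) / (b - a) := by
        field_simp
      have hT : |(Chebyshev.T ℝ m).eval ((b + a) / (b - a) - 2 / (b - a) * x)| ≤ 1 := by
        rw [hx]
        apply abs_eval_T_le_one
        · rw [le_div_iff₀ hba]; linarith
        · rw [div_le_one hba]; linarith
      have hti : t⁻¹ ≤ 2 * μ ^ m := by
        have hp : 0 < μ ^ m := by positivity
        rw [inv_le_comm₀ ht0 (by positivity), htv, mul_inv, inv_pow]
        have : 0 < (μ ^ m)⁻¹ := by positivity
        linarith
      calc t⁻¹ * _ ≤ t⁻¹ * 1 := by gcongr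
        _ ≤ _ := by linarith

/-- The factor that deflation contributes to the error bound.  It is positive for all arguments, so
that no case distinction is needed where the spectral data are degenerate. -/
noncomputable def deflationConst (m : ℕ) (a b d : ℝ) : ℝ :=
  2 * (1 + |d / a / cgRate (d / b)|) ^ m

lemma deflationConst_pos (m : ℕ) (a b d : ℝ) : 0 < deflationConst m a b d := by
  unfold deflationConst
  positivity

/-- A residual polynomial that annihilates the `r - 1` smallest nodes and is of Chebyshev type on
the remaining ones.  Each linear deflation factor costs one degree and the constant
`ev n / ev 1`. -/
lemma exists_deflated_polynomial {n r : ℕ} {ev : ℕ → ℝ} (hmono : MonotoneOn ev (Set.Icc 1 n))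
    (hpos : ∀ j ∈ Set.Icc 1 n, 0 < ev j) (hr : 1 ≤ r) (hrn : r ≤ n)
    (hlt : 1 < r → ev r < ev n) (k : ℕ) :
    ∃ f : ℝ[X], f.natDegree ≤ k ∧ f.eval 0 = 1 ∧ ∀ j ∈ Set.Icc 1 n,
      |f.eval (ev j)| ≤
        deflationConst (r - 1) (ev 1) (ev r) (ev n) * cgRate (ev n / ev r) ^ k := by
  have m1 : 1 ∈ Set.Icc 1 n := ⟨le_rfl, hr.trans hrn⟩
  have mr : r ∈ Set.Icc 1 n := ⟨hr, hrn⟩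
  have mn : n ∈ Set.Icc 1 n := ⟨hr.trans hrn, le_rfl⟩
  have p1 := hpos 1 m1
  have pr := hpos r mr
  have hrn' : ev r ≤ ev n := hmono mr mn hrn
  have h1n : ev 1 ≤ ev n := hmono m1 mn mn.1
  set μ := cgRate (ev n / ev r) with hμ
  have hμ0 : 0 ≤ μ := cgRate_nonneg pr hrn'
  have hμ1 : μ ≤ 1 := cgRate_le_one pr hrn'
  have hμpos : 1 < r → 0 < μ := fun h => cgRate_pos pr (hlt h)
  have hq : 1 ≤ ev n / ev 1 := (one_le_div p1).2 h1n
  -- the constant absorbs the deflation factors and the `r - 1` degrees spent on them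
  have hC : 2 * (ev n / ev 1) ^ (r - 1) ≤
      deflationConst (r - 1) (ev 1) (ev r) (ev n) * μ ^ (r - 1) := by
    rcases hr.eq_or_lt with h | h
    · simp [deflationConst, ← h]
    · have hm := hμpos h
      rw [deflationConst, mul_assoc, ← mul_pow, ← hμ]
      gcongr
      have : ev n / ev 1 = ev n / ev 1 / μ * μ := by field_simp
      calc ev n / ev 1 = ev n / ev 1 / μ * μ := this
        _ ≤ (1 + |ev n / ev 1 / μ|) * μ := by
          gcongr
          linarith [le_abs_self (ev n / ev 1 / μ)]
  rcases le_or_gt (r - 1) k with hk | hk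
  · obtain ⟨g, hgd, hg0, hg⟩ := exists_chebyshev_bound pr hrn' (k - (r - 1))
    refine ⟨(∏ i ∈ Finset.Ico 1 r, (1 - C (ev i)⁻¹ * X)) * g, ?_, ?_, fun j hj => ?_⟩
    · have hprod : (∏ i ∈ Finset.Ico 1 r, (1 - C (ev i)⁻¹ * X : ℝ[X])).natDegree ≤ r - 1 := by
        refine (natDegree_prod_le _ _).trans ?_
        refine (Finset.sum_le_card_nsmul _ _ 1 fun i _ => ?_).trans (by simp)
        compute_degree
      exact natDegree_mul_le.trans (by omega)
    · simp [eval_prod, hg0]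
    · rw [eval_mul, eval_prod, abs_mul, Finset.abs_prod]
      rcases lt_or_ge j r with hjr | hjr
      · rw [Finset.prod_eq_zero (Finset.mem_Ico.2 ⟨hj.1, hjr⟩)
          (by simp [(hpos j hj).ne']), zero_mul]
        exact mul_nonneg (deflationConst_pos _ _ _ _).le (pow_nonneg hμ0 _)
      · have hfac : ∏ i ∈ Finset.Ico 1 r, |eval (ev j) (1 - C (ev i)⁻¹ * X)| ≤
            (ev n / ev 1) ^ (r - 1) := by
          rw [← Nat.card_Ico 1 r, ← Finset.prod_const]
          refine Finset.prod_le_prod (fun _ _ => abs_nonneg _) fun i hi => ?_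
          obtain ⟨hi1, hi2⟩ := Finset.mem_Ico.1 hi
          have mi : i ∈ Set.Icc 1 n := ⟨hi1, by omega⟩
          have pi := hpos i mi
          have hij : ev i ≤ ev j := hmono mi hj (by omega)
          have h1 : 1 ≤ (ev i)⁻¹ * ev j := by
            rw [inv_mul_eq_div]; exact (one_le_div pi).2 hij
          have h2 : (ev i)⁻¹ * ev j ≤ ev n / ev 1 := by
            rw [inv_mul_eq_div]
            exact div_le_div₀ (p1.le.trans h1n) (hmono hj mn hj.2) p1 (hmono m1 mi hi1)
          simp only [eval_sub, eval_one, eval_mul, eval_C, eval_X]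
          rw [abs_le]
          constructor <;> linarith
        calc _ ≤ (ev n / ev 1) ^ (r - 1) * (2 * μ ^ (k - (r - 1))) :=
              mul_le_mul hfac (hg _ (hmono mr hj hjr) (hmono hj mn hj.2)) (abs_nonneg _)
                (by positivity)
          _ = 2 * (ev n / ev 1) ^ (r - 1) * μ ^ (k - (r - 1)) := by ring
          _ ≤ deflationConst (r - 1) (ev 1) (ev r) (ev n) * μ ^ (r - 1) *
                μ ^ (k - (r - 1)) := by gcongr
          _ = _ := by rw [mul_assoc, ← pow_add, Nat.add_sub_cancel' hk]
  · -- too few degrees for deflation: the constant polynomial suffices, as `μ ^ (r - 1) ≤ μ ^ k`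
    refine ⟨1, by simp, by simp, fun j _ => ?_⟩
    have h1 : (1 : ℝ) ≤ (ev n / ev 1) ^ (r - 1) := one_le_pow₀ hq
    have h2 : μ ^ (r - 1) ≤ μ ^ k := pow_le_pow_of_le_one hμ0 hμ1 hk.le
    rw [eval_one, abs_one]
    calc (1 : ℝ) ≤ 2 * (ev n / ev 1) ^ (r - 1) := by linarith
      _ ≤ _ := hC
      _ ≤ _ := by
        gcongr
        exact (deflationConst_pos _ _ _ _).le

end Polynomials

variable {n q p : ℕ}

/-! ### The energy inner product and minimizers -/

/-- The energy inner product `tr (Xᵀ A Y)` of block vectors, as a bilinear form. -/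
noncomputable def energyForm (A : Matrix (Fin n) (Fin n) ℝ) :
    BlockVec n q p →ₗ[ℝ] BlockVec n q p →ₗ[ℝ] ℝ :=
  LinearMap.mk₂ ℝ (fun X Y => (X.transpose * A * Y).trace)
    (by intros; simp [Matrix.add_mul])
    (by intros; simp)
    (by intros; simp [Matrix.mul_add])
    (by intros; simp)

lemma energyForm_apply (A : Matrix (Fin n) (Fin n) ℝ) (X Y : BlockVec n q p) :
    energyForm A X Y = (X.transpose * A * Y).trace := rfl

lemma energyForm_comm {A : Matrix (Fin n) (Fin n) ℝ} (hA : A.PosDef) (X Y : BlockVec n q p) :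
    energyForm A X Y = energyForm A Y X := by
  have h : A.transpose = A := by simpa using hA.isHermitian.eq
  rw [energyForm_apply, ← Matrix.trace_transpose]
  simp [Matrix.transpose_mul, h, energyForm_apply, Matrix.mul_assoc]

lemma blockEnergyNorm_eq_sqrt (A : Matrix (Fin n) (Fin n) ℝ) (X : BlockVec n q p) :
    blockEnergyNorm A X = √(energyForm A X X) := rfl

lemma energyForm_self_eq_sum (A : Matrix (Fin n) (Fin n) ℝ) (X : BlockVec n q p) :
    energyForm A X X = ∑ i, dotProduct (X.col i) (A.mulVec (X.col i)) := by
  rw [energyForm_apply, Matrix.trace, Matrix.mul_assoc]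
  rfl

lemma dotProduct_mulVec_self_nonneg {A : Matrix (Fin n) (Fin n) ℝ} (hA : A.PosDef)
    (x : Fin n → ℝ) : 0 ≤ dotProduct x (A.mulVec x) := by
  simpa using hA.posSemidef.dotProduct_mulVec_nonneg x

lemma energyForm_self_nonneg {A : Matrix (Fin n) (Fin n) ℝ} (hA : A.PosDef)
    (X : BlockVec n q p) : 0 ≤ energyForm A X X := by
  rw [energyForm_self_eq_sum]
  exact Finset.sum_nonneg fun i _ => dotProduct_mulVec_self_nonneg hA _

lemma eq_zero_of_energyForm_self {A : Matrix (Fin n) (Fin n) ℝ} (hA : A.PosDef)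
    {X : BlockVec n q p} (h : energyForm A X X = 0) : X = 0 := by
  rw [energyForm_self_eq_sum,
    Finset.sum_eq_zero_iff_of_nonneg fun i _ => dotProduct_mulVec_self_nonneg hA _] at h
  ext a i
  by_contra hne
  have hx : X.col i ≠ 0 := fun h0 => hne (congrFun h0 a)
  have := hA.dotProduct_mulVec_pos hx
  simp only [star_trivial] at this
  exact this.ne' (h i (Finset.mem_univ i))

lemma energyNorm_col_le {A : Matrix (Fin n) (Fin n) ℝ} (hA : A.PosDef) (X : BlockVec n q p)
    (i : Fin q × Fin p) : energyNorm A (X.col i) ≤ blockEnergyNorm A X := by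
  rw [blockEnergyNorm_eq_sqrt, energyForm_self_eq_sum]
  exact Real.sqrt_le_sqrt (Finset.single_le_sum
    (f := fun i => dotProduct (X.col i) (A.mulVec (X.col i)))
    (fun i _ => dotProduct_mulVec_self_nonneg hA _) (Finset.mem_univ i))

lemma blockEnergyNorm_neg (A : Matrix (Fin n) (Fin n) ℝ) (X : BlockVec n q p) :
    blockEnergyNorm A (-X) = blockEnergyNorm A X := by
  simp [blockEnergyNorm]

/-- The block Krylov space is a linear subspace. -/
def krylovSubmodule (S : StarSubalgebra ℝ (Coeff q p)) (T : Matrix (Fin n) (Fin n) ℝ)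
    (R : BlockVec n q p) (k : ℕ) : Submodule ℝ (BlockVec n q p) where
  carrier := krylov S T R k
  add_mem' := by
    rintro _ _ ⟨c, hc, rfl⟩ ⟨d, hd, rfl⟩
    exact ⟨fun i => c i + d i, fun i => add_mem (hc i) (hd i),
      by simp [Matrix.mul_add, Finset.sum_add_distrib]⟩
  zero_mem' := ⟨fun _ => 0, fun _ => zero_mem S, by simp⟩
  smul_mem' := by
    rintro a _ ⟨c, hc, rfl⟩
    exact ⟨fun i => a • c i, fun i => SMulMemClass.smul_mem a (hc i), by simp [Finset.smul_sum]⟩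

/-- Orthogonal projection with respect to the energy inner product: on a finite-dimensional space,
a nondegenerate form represents every functional. -/
lemma exists_energy_projection {A : Matrix (Fin n) (Fin n) ℝ} (hA : A.PosDef)
    (K : Submodule ℝ (BlockVec n q p)) (E : BlockVec n q p) :
    ∃ Y ∈ K, ∀ Z ∈ K, energyForm A Z (E - Y) = 0 := by
  let L : K →ₗ[ℝ] Module.Dual ℝ K :=
    ((energyForm A).compl₁₂ K.subtype K.subtype)
  have hinj : Function.Injective L := by
    rw [injective_iff_map_eq_zero]
    intro Y hY
    have h : energyForm A (Y : BlockVec n q p) Y = 0 := LinearMap.congr_fun hY Y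
    exact Subtype.ext (eq_zero_of_energyForm_self hA h)
  obtain ⟨Y, hY⟩ := (LinearMap.injective_iff_surjective_of_finrank_eq_finrank
    (Subspace.dual_finrank_eq (K := ℝ) (V := K)).symm).1 hinj
      ((energyForm A E).comp K.subtype)
  refine ⟨Y, Y.2, fun Z hZ => ?_⟩
  have h : energyForm A (Y : BlockVec n q p) Z = energyForm A E Z :=
    LinearMap.congr_fun hY ⟨Z, hZ⟩
  rw [energyForm_comm hA, map_sub, LinearMap.sub_apply, h, sub_self]

/-- Pythagoras' theorem in the energy inner product. -/
lemma energyForm_add_of_orthogonal {A : Matrix (Fin n) (Fin n) ℝ} (hA : A.PosDef)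
    {X Y : BlockVec n q p} (h : energyForm A X Y = 0) :
    energyForm A (X + Y) (X + Y) = energyForm A X X + energyForm A Y Y := by
  have h' := energyForm_comm hA Y X
  simp only [map_add, LinearMap.add_apply, h, h']
  ring

lemma inv_mul_eq_of_mul_eq {A : Matrix (Fin n) (Fin n) ℝ} (hA : A.PosDef)
    {B Xstar : BlockVec n q p} (h : A * Xstar = B) : A⁻¹ * B = Xstar := by
  rw [← h, ← Matrix.mul_assoc,
    Matrix.nonsing_inv_mul _ ((Matrix.isUnit_iff_isUnit_det A).1 hA.isUnit), Matrix.one_mul]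

/-- The Galerkin condition characterizes minimizers: an element of the affine Krylov space whose
error is energy-orthogonal to the Krylov space is an iterate. -/
lemma isBCGIterate_of_orthogonal {S : StarSubalgebra ℝ (Coeff q p)}
    {A M : Matrix (Fin n) (Fin n) ℝ} (hA : A.PosDef) {B X0 Xstar : BlockVec n q p}
    (hX : A * Xstar = B) {k : ℕ} {Y : BlockVec n q p}
    (hY : Y - X0 ∈ krylov S (M⁻¹ * A) (M⁻¹ * (B - A * X0)) k)
    (horth : ∀ Z ∈ krylov S (M⁻¹ * A) (M⁻¹ * (B - A * X0)) k,
      energyForm A Z (Xstar - Y) = 0) :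
    IsBCGIterate S A M B X0 k Y ∧ ∀ Y', IsBCGIterate S A M B X0 k Y' → Y' = Y := by
  let K := krylovSubmodule S (M⁻¹ * A) (M⁻¹ * (B - A * X0)) k
  have key : ∀ Z, Z - X0 ∈ K → energyForm A (Z - Xstar) (Z - Xstar) =
      energyForm A (Z - Y) (Z - Y) + energyForm A (Y - Xstar) (Y - Xstar) := by
    intro Z hZ
    have h1 : Z - Y ∈ K := by
      have := K.sub_mem hZ hY
      rwa [sub_sub_sub_cancel_right] at this
    have h2 : energyForm A (Z - Y) (Y - Xstar) = 0 := by
      rw [← neg_sub Xstar Y, map_neg, horth _ h1, neg_zero]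
    rw [← energyForm_add_of_orthogonal hA h2, sub_add_sub_cancel]
  refine ⟨⟨?_, hY⟩, fun Y' hY' => ?_⟩
  · intro Z hZ
    simp only [Set.mem_ofPred_eq, inv_mul_eq_of_mul_eq hA hX, blockEnergyNorm_eq_sqrt]
    apply Real.sqrt_le_sqrt
    rw [key Z hZ]
    linarith [energyForm_self_nonneg hA (Z - Y)]
  · have hle := hY'.1 (show Y ∈ {Z | Z - X0 ∈ krylov S (M⁻¹ * A) (M⁻¹ * (B - A * X0)) k} from hY)
    simp only [Set.mem_ofPred_eq, inv_mul_eq_of_mul_eq hA hX, blockEnergyNorm_eq_sqrt] at hle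
    rw [Real.sqrt_le_sqrt_iff (energyForm_self_nonneg hA _), key Y' hY'.2] at hle
    have h0 : energyForm A (Y' - Y) (Y' - Y) = 0 :=
      le_antisymm (by linarith) (energyForm_self_nonneg hA _)
    exact sub_eq_zero.1 (eq_zero_of_energyForm_self hA h0)

lemma existsUnique_isBCGIterate (S : StarSubalgebra ℝ (Coeff q p))
    {A : Matrix (Fin n) (Fin n) ℝ} (M : Matrix (Fin n) (Fin n) ℝ) (hA : A.PosDef)
    {B Xstar : BlockVec n q p} (X0 : BlockVec n q p) (hX : A * Xstar = B) (k : ℕ) :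
    ∃! Y, IsBCGIterate S A M B X0 k Y := by
  obtain ⟨D, hD, horth⟩ := exists_energy_projection hA
    (krylovSubmodule S (M⁻¹ * A) (M⁻¹ * (B - A * X0)) k) (Xstar - X0)
  obtain ⟨h1, h2⟩ := isBCGIterate_of_orthogonal (Y := X0 + D) hA hX
    (by rw [add_sub_cancel_left]; exact hD)
    (fun Z hZ => by rw [← sub_sub]; exact horth Z hZ)
  exact ⟨_, h1, h2⟩

/-! ### Spectral bounds for polynomials in the preconditioned operator -/

open Polynomial in
lemma posSemidef_aeval {H : Matrix (Fin n) (Fin n) ℝ} (hH : H.IsHermitian) {g : ℝ[X]}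
    (hg : ∀ x ∈ spectrum ℝ H, 0 ≤ g.eval x) : (aeval H g).PosSemidef := by
  rw [← Matrix.nonneg_iff_posSemidef, ← cfc_polynomial g H hH]
  exact cfc_nonneg hg

open Polynomial in
/-- Intertwining relations pass to polynomials. -/
lemma aeval_mul_eq_mul_aeval {T H G : Matrix (Fin n) (Fin n) ℝ} (h : G * T = H * G) (f : ℝ[X]) :
    G * aeval T f = aeval H f * G := by
  have hpow : ∀ i : ℕ, G * T ^ i = H ^ i * G := fun i => by
    induction i with
    | zero => simp
    | succ i ih => rw [pow_succ, ← mul_assoc, ih, mul_assoc, h, ← mul_assoc, ← pow_succ]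
  simp only [aeval_eq_sum_range, Finset.mul_sum, Finset.sum_mul, Matrix.mul_smul, Matrix.smul_mul,
    hpow]

lemma sqrt_posDef {M : Matrix (Fin n) (Fin n) ℝ} (hM : M.PosDef) : (CFC.sqrt M).PosDef := by
  have h : (CFC.sqrt M).PosSemidef := Matrix.nonneg_iff_posSemidef.1 (CFC.sqrt_nonneg M)
  refine h.posDef_iff_isUnit.2 ?_
  have := hM.isUnit
  rw [← CFC.sqrt_mul_sqrt_self M hM.posSemidef.nonneg] at this
  exact isUnit_of_mul_isUnit_left this

lemma precond_posDef {A M : Matrix (Fin n) (Fin n) ℝ} (hA : A.PosDef) (hM : M.PosDef) :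
    (precond A M).PosDef := by
  have hG := (sqrt_posDef hM).inv
  have h := hA.conjTranspose_mul_mul_same (B := (CFC.sqrt M)⁻¹)
    (Matrix.mulVec_injective_iff_isUnit.2 hG.isUnit)
  rwa [hG.isHermitian.eq] at h

lemma IsOrderedSpectrum.exists_eq_of_mem_spectrum {T : Matrix (Fin n) (Fin n) ℝ} {ev : ℕ → ℝ}
    (h : IsOrderedSpectrum T ev) {x : ℝ} (hx : x ∈ spectrum ℝ T) :
    ∃ j ∈ Set.Icc 1 n, x = ev j := by
  have hr := Matrix.mem_spectrum_iff_isRoot_charpoly.1 hx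
  rw [h.2, Polynomial.IsRoot, Polynomial.eval_prod, Finset.prod_eq_zero_iff] at hr
  obtain ⟨j, hj, h0⟩ := hr
  exact ⟨j, Finset.mem_Icc.1 hj, by simpa [sub_eq_zero] using h0⟩

lemma IsOrderedSpectrum.pos {T : Matrix (Fin n) (Fin n) ℝ} {ev : ℕ → ℝ}
    (h : IsOrderedSpectrum T ev) (hT : T.PosDef) : ∀ j ∈ Set.Icc 1 n, 0 < ev j := by
  intro j hj
  have hx : ev j ∈ spectrum ℝ T := by
    rw [Matrix.mem_spectrum_iff_isRoot_charpoly, h.2, Polynomial.IsRoot, Polynomial.eval_prod]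
    exact Finset.prod_eq_zero (Finset.mem_Icc.2 hj) (by simp)
  rw [hT.isHermitian.spectrum_real_eq_range_eigenvalues] at hx
  obtain ⟨i, hi⟩ := hx
  rw [← hi]
  exact hT.eigenvalues_pos i

open Polynomial in
/-- A polynomial in the preconditioned operator `M⁻¹ A` is bounded, in the energy norm, by its
values on the spectrum of the similar symmetric matrix `M^(-1/2) A M^(-1/2)`. -/
lemma blockEnergyNorm_aeval_mul_le {A M : Matrix (Fin n) (Fin n) ℝ} (hA : A.PosDef)
    (hM : M.PosDef) {f : ℝ[X]} {c : ℝ} (hc : 0 ≤ c)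
    (hf : ∀ x ∈ spectrum ℝ (precond A M), |f.eval x| ≤ c) (E : BlockVec n q p) :
    blockEnergyNorm A (aeval (M⁻¹ * A) f * E) ≤ c * blockEnergyNorm A E := by
  set G := CFC.sqrt M with hG
  set H := precond A M with hH
  have hGp : G.PosDef := sqrt_posDef hM
  have hHp : H.PosDef := precond_posDef hA hM
  have hGdet : IsUnit G.det := (Matrix.isUnit_iff_isUnit_det G).1 hGp.isUnit
  have hGG : G * G = M := CFC.sqrt_mul_sqrt_self M hM.posSemidef.nonneg
  have hAG : A = G * H * G := by
    rw [hH, precond, ← hG]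
    simp only [Matrix.mul_assoc, Matrix.nonsing_inv_mul _ hGdet, Matrix.mul_one]
    rw [← Matrix.mul_assoc, Matrix.mul_nonsing_inv _ hGdet, Matrix.one_mul]
  have hint : G * (M⁻¹ * A) = H * G := by
    rw [← hGG, Matrix.mul_inv_rev, hH, precond, ← hG]
    simp only [Matrix.mul_assoc, Matrix.nonsing_inv_mul _ hGdet, Matrix.mul_one]
    rw [← Matrix.mul_assoc, Matrix.mul_nonsing_inv _ hGdet, Matrix.one_mul]
  set F := aeval (M⁻¹ * A) f with hF
  have hGF : G * F = aeval H f * G := aeval_mul_eq_mul_aeval hint f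
  have hpsd : (aeval H (C (c ^ 2) * X - f * X * f)).PosSemidef := by
    refine posSemidef_aeval hHp.isHermitian fun x hx => ?_
    have hx0 : 0 < x := by
      rw [hHp.isHermitian.spectrum_real_eq_range_eigenvalues] at hx
      obtain ⟨i, rfl⟩ := hx
      exact hHp.eigenvalues_pos i
    have h2 : f.eval x ^ 2 ≤ c ^ 2 := sq_le_sq' (abs_le.1 (hf x hx)).1 (abs_le.1 (hf x hx)).2
    simp only [eval_sub, eval_mul, eval_C, eval_X]
    nlinarith
  have hGt : G.transpose = G := by simpa using hGp.isHermitian.eq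
  have hHt : (aeval H f).transpose = aeval H f := by
    have hs : H.transpose = H := by simpa using hHp.isHermitian.eq
    simp [aeval_eq_sum_range, Matrix.transpose_sum, Matrix.transpose_pow, hs]
  have hFt : F.transpose * G = G * aeval H f := by
    have := congrArg Matrix.transpose hGF
    rwa [Matrix.transpose_mul, Matrix.transpose_mul, hGt, hHt] at this
  have hdiff : (G * E).transpose * aeval H (C (c ^ 2) * X - f * X * f) * (G * E) =
      c ^ 2 • (E.transpose * A * E) - (F * E).transpose * A * (F * E) := by
    have h1 : (F * E).transpose * A * (F * E) =
        E.transpose * (F.transpose * G) * H * (G * F) * E := by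
      rw [hAG]; simp only [Matrix.transpose_mul, Matrix.mul_assoc]
    have h2 : E.transpose * A * E = E.transpose * G * H * G * E := by
      rw [hAG]; simp only [Matrix.mul_assoc]
    rw [h1, h2, hFt, hGF]
    simp only [map_sub, map_mul, aeval_X, aeval_C, Algebra.algebraMap_eq_smul_one,
      Matrix.transpose_mul, hGt, Matrix.mul_sub, Matrix.sub_mul, Matrix.mul_assoc,
      Matrix.smul_mul, Matrix.mul_smul, Matrix.one_mul]
  have htr := (hpsd.conjTranspose_mul_mul_same (G * E)).trace_nonneg
  rw [Matrix.conjTranspose_eq_transpose_of_trivial, hdiff, Matrix.trace_sub, Matrix.trace_smul,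
    smul_eq_mul] at htr
  rw [blockEnergyNorm, blockEnergyNorm]
  nth_rewrite 1 [← Real.sqrt_sq hc]
  rw [← Real.sqrt_mul (sq_nonneg c)]
  exact Real.sqrt_le_sqrt (by linarith)

open Polynomial in
/-- A polynomial of degree at most `k` with value `1` at `0`, evaluated at `M⁻¹ A`, sends the
initial error to the error of an element of the affine Krylov space.  Only scalar coefficients are
used, so that this holds for every coefficient algebra. -/
lemma sub_aeval_mul_mem_krylov (S : StarSubalgebra ℝ (Coeff q p))
    {A M : Matrix (Fin n) (Fin n) ℝ} {B X0 Xstar : BlockVec n q p} (hX : A * Xstar = B)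
    {f : ℝ[X]} {k : ℕ} (hd : f.natDegree ≤ k) (h0 : f.eval 0 = 1) :
    Xstar - aeval (M⁻¹ * A) f * (Xstar - X0) - X0 ∈
      krylov S (M⁻¹ * A) (M⁻¹ * (B - A * X0)) k := by
  set T := M⁻¹ * A with hT
  have hR : M⁻¹ * (B - A * X0) = T * (Xstar - X0) := by
    rw [← hX, ← Matrix.mul_sub, ← Matrix.mul_assoc]
  refine ⟨fun i => -f.coeff (i + 1) • (1 : Coeff q p),
    fun i => SMulMemClass.smul_mem _ (one_mem S), ?_⟩
  have hsum : aeval T f = 1 + ∑ i ∈ Finset.range k, f.coeff (i + 1) • T ^ (i + 1) := by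
    rw [aeval_eq_sum_range' (Nat.lt_succ_of_le hd), Finset.sum_range_succ', add_comm]
    congr 1
    rw [coeff_zero_eq_eval_zero, h0, pow_zero, one_smul]
  rw [hR, hsum, Matrix.add_mul, Matrix.one_mul, Matrix.sum_mul]
  have : ∀ i ∈ Finset.range k, T ^ i * (T * (Xstar - X0)) * (-f.coeff (i + 1) • (1 : Coeff q p)) =
      -(f.coeff (i + 1) • T ^ (i + 1) * (Xstar - X0)) := fun i _ => by
    rw [← Matrix.mul_assoc, ← pow_succ, Matrix.mul_smul, Matrix.mul_one, neg_smul, Matrix.smul_mul]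
  rw [Finset.sum_congr rfl this, Finset.sum_neg_distrib]
  abel

open Polynomial in
/-- The energy error of an iterate is at most the initial one times the maximum over the spectrum
of any admissible residual polynomial. -/
lemma IsBCGIterate.blockEnergyNorm_le {S : StarSubalgebra ℝ (Coeff q p)}
    {A M : Matrix (Fin n) (Fin n) ℝ} (hA : A.PosDef) (hM : M.PosDef)
    {B X0 Xstar : BlockVec n q p} (hX : A * Xstar = B) {k : ℕ} {Y : BlockVec n q p}
    (hY : IsBCGIterate S A M B X0 k Y) {f : ℝ[X]} (hd : f.natDegree ≤ k) (h0 : f.eval 0 = 1)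
    {c : ℝ} (hc : 0 ≤ c) (hf : ∀ x ∈ spectrum ℝ (precond A M), |f.eval x| ≤ c) :
    blockEnergyNorm A (Xstar - Y) ≤ c * blockEnergyNorm A (Xstar - X0) := by
  have h := hY.1 (show Xstar - aeval (M⁻¹ * A) f * (Xstar - X0) ∈ _ from
    sub_aeval_mul_mem_krylov S hX hd h0)
  simp only [Set.mem_ofPred_eq, inv_mul_eq_of_mul_eq hA hX] at h
  rw [← neg_sub, blockEnergyNorm_neg]
  refine h.trans ?_
  rw [sub_sub_cancel_left, blockEnergyNorm_neg]
  exact blockEnergyNorm_aeval_mul_le hA hM hc hf _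

/-! ### The matrix-valued inner product -/

lemma slice_mul (A : Matrix (Fin n) (Fin n) ℝ) (X : BlockVec n q p) (j : Fin q) :
    slice (A * X) j = A * slice X j := rfl

lemma slice_mul_kronecker (X : BlockVec n q p) (γ : Matrix (Fin p) (Fin p) ℝ) (j : Fin q) :
    slice (X * ((1 : Matrix (Fin q) (Fin q) ℝ) ⊗ₖ γ)) j = slice X j * γ := by
  ext a l
  simp [slice, Matrix.mul_apply, Fintype.sum_prod_type, Matrix.kroneckerMap_apply,
    Matrix.one_apply, ite_mul]

lemma blockInner_mem (X Y : BlockVec n q p) : blockInner X Y ∈ blockGlobal q p :=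
  SMulMemClass.smul_mem _ (sum_mem fun _ _ => ⟨_, rfl⟩)

lemma inv_mem_blockGlobal {σ : Coeff q p} (hσ : σ ∈ blockGlobal q p) : σ⁻¹ ∈ blockGlobal q p := by
  obtain ⟨γ, rfl⟩ := hσ
  exact ⟨γ⁻¹, by rw [Matrix.inv_kronecker, inv_one]⟩

lemma blockInner_transpose (X Y : BlockVec n q p) :
    (blockInner X Y).transpose = blockInner Y X := by
  simp [blockInner, Matrix.transpose_sum, ← Matrix.kroneckerMap_transpose, Matrix.transpose_mul]

lemma blockInner_add_right (X Y Z : BlockVec n q p) :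
    blockInner X (Y + Z) = blockInner X Y + blockInner X Z := by
  have h : ∀ j, slice (Y + Z) j = slice Y j + slice Z j := fun _ => rfl
  simp [blockInner, h, Matrix.mul_add, Matrix.kronecker_add, Finset.sum_add_distrib]

lemma blockInner_mul_right (X Y : BlockVec n q p) {σ : Coeff q p} (hσ : σ ∈ blockGlobal q p) :
    blockInner X (Y * σ) = blockInner X Y * σ := by
  obtain ⟨γ, rfl⟩ := hσ
  simp [blockInner, slice_mul_kronecker, Finset.sum_mul, ← Matrix.mul_kronecker_mul,
    Matrix.mul_assoc]

lemma blockInner_smul_right (X Y : BlockVec n q p) (a : ℝ) :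
    blockInner X (a • Y) = a • blockInner X Y := by
  have h := blockInner_mul_right X Y (SMulMemClass.smul_mem a (one_mem (blockGlobal q p)))
  simpa using h

lemma blockInner_sub_right (X Y Z : BlockVec n q p) :
    blockInner X (Y - Z) = blockInner X Y - blockInner X Z := by
  rw [eq_sub_iff_add_eq, ← blockInner_add_right, sub_add_cancel]

lemma blockInner_add_left (X Y Z : BlockVec n q p) :
    blockInner (X + Y) Z = blockInner X Z + blockInner Y Z := by
  rw [← blockInner_transpose, blockInner_add_right, Matrix.transpose_add, blockInner_transpose,
    blockInner_transpose]

lemma blockInner_sub_left (X Y Z : BlockVec n q p) :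
    blockInner (X - Y) Z = blockInner X Z - blockInner Y Z := by
  rw [← blockInner_transpose, blockInner_sub_right, Matrix.transpose_sub, blockInner_transpose,
    blockInner_transpose]

lemma blockInner_mul_left (X Y : BlockVec n q p) {σ : Coeff q p} (hσ : σ ∈ blockGlobal q p) :
    blockInner (X * σ) Y = σ.transpose * blockInner X Y := by
  rw [← blockInner_transpose, blockInner_mul_right Y X hσ, Matrix.transpose_mul,
    blockInner_transpose]

lemma blockInner_smul_left (X Y : BlockVec n q p) (a : ℝ) :
    blockInner (a • X) Y = a • blockInner X Y := by
  rw [← blockInner_transpose, blockInner_smul_right, Matrix.transpose_smul, blockInner_transpose]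

lemma blockInner_zero_left (Y : BlockVec n q p) : blockInner 0 Y = 0 := by
  simpa using blockInner_smul_left 0 Y 0

lemma blockInner_mul_comm_of_isHermitian {A : Matrix (Fin n) (Fin n) ℝ} (hA : A.IsHermitian)
    (X Y : BlockVec n q p) : blockInner (A * X) Y = blockInner X (A * Y) := by
  have h : A.transpose = A := by simpa using hA.eq
  simp [blockInner, slice_mul, Matrix.transpose_mul, h, Matrix.mul_assoc]

/-- The block inner product refines the Frobenius inner product. -/
lemma trace_blockInner (hq : 0 < q) (X Y : BlockVec n q p) :
    (blockInner X Y).trace = (X.transpose * Y).trace := by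
  have hq' : (q : ℝ) ≠ 0 := by positivity
  rw [blockInner, Matrix.trace_smul, Matrix.trace_sum]
  simp only [Matrix.trace_kronecker, Matrix.trace_one, Fintype.card_fin]
  rw [← Finset.mul_sum, smul_eq_mul, ← mul_assoc, one_div_mul_cancel hq', one_mul]
  simp [Matrix.trace, Matrix.mul_apply, Fintype.sum_prod_type, slice]

/-! ### Krylov spaces as modules -/

lemma krylov_mono (S : StarSubalgebra ℝ (Coeff q p)) (T : Matrix (Fin n) (Fin n) ℝ)
    (R : BlockVec n q p) {k l : ℕ} (hkl : k ≤ l) : krylov S T R k ⊆ krylov S T R l := by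
  rintro _ ⟨c, hc, rfl⟩
  refine ⟨fun i => if i < k then c i else 0, fun i => ?_, ?_⟩
  · dsimp only
    split_ifs
    exacts [hc i, zero_mem S]
  · rw [← Finset.sum_subset (Finset.range_mono hkl)]
    · exact Finset.sum_congr rfl fun i hi => by simp [Finset.mem_range.1 hi]
    · intro i _ hi
      have : ¬ i < k := by simpa using hi
      simp [this]

lemma mul_coeff_mem_krylov {S : StarSubalgebra ℝ (Coeff q p)} {T : Matrix (Fin n) (Fin n) ℝ}
    {R Y : BlockVec n q p} {k : ℕ} (hY : Y ∈ krylov S T R k) {σ : Coeff q p} (hσ : σ ∈ S) :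
    Y * σ ∈ krylov S T R k := by
  obtain ⟨c, hc, rfl⟩ := hY
  exact ⟨fun i => c i * σ, fun i => mul_mem (hc i) hσ, by simp [Matrix.sum_mul, Matrix.mul_assoc]⟩

lemma mul_mem_krylov_succ {S : StarSubalgebra ℝ (Coeff q p)} {T : Matrix (Fin n) (Fin n) ℝ}
    {R Y : BlockVec n q p} {k : ℕ} (hY : Y ∈ krylov S T R k) : T * Y ∈ krylov S T R (k + 1) := by
  obtain ⟨c, hc, rfl⟩ := hY
  refine ⟨fun i => Nat.casesOn i 0 c, fun i => ?_, ?_⟩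
  · cases i
    exacts [zero_mem S, hc _]
  · rw [Finset.sum_range_succ', Matrix.mul_sum]
    simp [pow_succ', Matrix.mul_assoc]

lemma self_mem_krylov_one (S : StarSubalgebra ℝ (Coeff q p)) (T : Matrix (Fin n) (Fin n) ℝ)
    (R : BlockVec n q p) : R ∈ krylov S T R 1 :=
  ⟨fun _ => 1, fun _ => one_mem S, by simp⟩

/-! ### The block conjugate gradient recurrence -/

section Run

variable (A M : Matrix (Fin n) (Fin n) ℝ) (B X0 : BlockVec n q p)

/-- The step length `λ^k = (α^k)⁻¹ ρ^k`. -/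
noncomputable def bcgLam (k : ℕ) : Coeff q p :=
  ((bcgRun A M B X0 k).alpha A)⁻¹ * (bcgRun A M B X0 k).rho M

/-- The direction update coefficient `β^k = (ρ^k)⁻¹ ρ^(k+1)`. -/
noncomputable def bcgBeta (k : ℕ) : Coeff q p :=
  ((bcgRun A M B X0 k).rho M)⁻¹ * (bcgRun A M B X0 (k + 1)).rho M

lemma bcgRun_succ_X (k : ℕ) : (bcgRun A M B X0 (k + 1)).X =
    (bcgRun A M B X0 k).X + (bcgRun A M B X0 k).P * bcgLam A M B X0 k := rfl

lemma bcgRun_succ_R (k : ℕ) : (bcgRun A M B X0 (k + 1)).R =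
    (bcgRun A M B X0 k).R - A * (bcgRun A M B X0 k).P * bcgLam A M B X0 k := rfl

lemma bcgRun_succ_P (k : ℕ) : (bcgRun A M B X0 (k + 1)).P =
    M⁻¹ * (bcgRun A M B X0 (k + 1)).R + (bcgRun A M B X0 k).P * bcgBeta A M B X0 k := rfl

lemma bcgLam_mem (k : ℕ) : bcgLam A M B X0 k ∈ blockGlobal q p :=
  mul_mem (inv_mem_blockGlobal (blockInner_mem _ _)) (blockInner_mem _ _)

lemma bcgBeta_mem (k : ℕ) : bcgBeta A M B X0 k ∈ blockGlobal q p :=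
  mul_mem (inv_mem_blockGlobal (blockInner_mem _ _)) (blockInner_mem _ _)

/-- The coefficient matrices of the first `k` steps are invertible, so that the algorithm does not
break down before it has computed `X^k`. -/
def NoBreakdown (k : ℕ) : Prop :=
  ∀ j < k, IsUnit ((bcgRun A M B X0 j).alpha A) ∧ IsUnit ((bcgRun A M B X0 j).rho M)

variable {A M B X0}

lemma NoBreakdown.isUnit_bcgLam {k : ℕ} (h : NoBreakdown A M B X0 k) {j : ℕ} (hj : j < k) :
    IsUnit (bcgLam A M B X0 j) :=
  (Matrix.isUnit_nonsing_inv_iff.2 (h j hj).1).mul (h j hj).2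

lemma bcgRun_R (k : ℕ) : (bcgRun A M B X0 k).R = B - A * (bcgRun A M B X0 k).X := by
  induction k with
  | zero => rfl
  | succ k ih =>
    rw [bcgRun_succ_R, bcgRun_succ_X, ih, Matrix.mul_add, Matrix.mul_assoc, sub_sub]

lemma rho_transpose (hM : M.PosDef) (st : BCGState n q p) :
    (st.rho M).transpose = st.rho M := by
  rw [BCGState.rho, blockInner_transpose, blockInner_mul_comm_of_isHermitian hM.inv.isHermitian]

/-- The preconditioned residuals lie in the span of the search directions, so they inherit
orthogonality from them. -/
lemma blockInner_precond_residual_eq_zero {k : ℕ} {Y : BlockVec n q p}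
    (h : ∀ j < k, blockInner (bcgRun A M B X0 j).P Y = 0) {j : ℕ} (hj : j < k) :
    blockInner (M⁻¹ * (bcgRun A M B X0 j).R) Y = 0 := by
  rcases j with _ | j
  · exact h 0 hj
  · have hP := bcgRun_succ_P A M B X0 j
    rw [← sub_eq_iff_eq_add] at hP
    rw [← hP, blockInner_sub_left, blockInner_mul_left _ _ (bcgBeta_mem ..), h _ hj,
      h j (by omega), Matrix.mul_zero, sub_zero]

lemma mul_P_mul_bcgLam (k : ℕ) : A * (bcgRun A M B X0 k).P * bcgLam A M B X0 k =
    (bcgRun A M B X0 k).R - (bcgRun A M B X0 (k + 1)).R := by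
  rw [bcgRun_succ_R, sub_sub_cancel]

/-- The orthogonality relations of the conjugate gradient method: residuals are orthogonal to the
earlier search directions, search directions are `A`-conjugate, and `⟨P^k, R^k⟩ = ρ^k`. -/
lemma bcgRun_orthogonality (hA : A.PosDef) (hM : M.PosDef) (k : ℕ) :
    NoBreakdown A M B X0 k →
      (∀ j < k, blockInner (bcgRun A M B X0 j).P (bcgRun A M B X0 k).R = 0) ∧
      (∀ j < k, blockInner (bcgRun A M B X0 j).P (A * (bcgRun A M B X0 k).P) = 0) ∧
      blockInner (bcgRun A M B X0 k).P (bcgRun A M B X0 k).R = (bcgRun A M B X0 k).rho M := by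
  induction k with
  | zero => exact fun _ => ⟨by simp, by simp, rfl⟩
  | succ k ih =>
    intro hk
    obtain ⟨ihR, ihA, ihρ⟩ := ih fun j hj => hk j (by omega)
    have hlam := bcgLam_mem A M B X0 k
    have hbeta := bcgBeta_mem A M B X0 k
    have hR : ∀ j < k + 1, blockInner (bcgRun A M B X0 j).P (bcgRun A M B X0 (k + 1)).R = 0 := by
      intro j hj
      rw [bcgRun_succ_R, blockInner_sub_right, blockInner_mul_right _ _ hlam]
      rcases (Nat.lt_succ_iff.1 hj).eq_or_lt with rfl | hj
      · have hα : blockInner (bcgRun A M B X0 j).P (A * (bcgRun A M B X0 j).P) =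
          (bcgRun A M B X0 j).alpha A := rfl
        have hu := (Matrix.isUnit_iff_isUnit_det _).1 (hk j (by omega)).1
        rw [ihρ, hα, bcgLam, ← Matrix.mul_assoc, Matrix.mul_nonsing_inv _ hu, Matrix.one_mul,
          sub_self]
      · rw [ihR j hj, ihA j hj, Matrix.zero_mul, sub_zero]
    have hZ : ∀ j < k + 1, blockInner (bcgRun A M B X0 j).R
        (M⁻¹ * (bcgRun A M B X0 (k + 1)).R) = 0 := fun j hj => by
      rw [← blockInner_mul_comm_of_isHermitian hM.inv.isHermitian]
      exact blockInner_precond_residual_eq_zero hR hj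
    refine ⟨hR, fun j hj => ?_, ?_⟩
    · -- multiplication by the invertible `λ^j` turns `A P^j` into a difference of residuals
      have hu := hk.isUnit_bcgLam hj
      rw [← Matrix.isUnit_transpose] at hu
      rw [← hu.mul_right_eq_zero, ← blockInner_mul_left _ _ (bcgLam_mem A M B X0 j),
        ← blockInner_mul_comm_of_isHermitian hA.isHermitian, ← Matrix.mul_assoc, mul_P_mul_bcgLam,
        bcgRun_succ_P, blockInner_add_right, blockInner_mul_right _ _ hbeta]
      rcases (Nat.lt_succ_iff.1 hj).eq_or_lt with rfl | hj'
      · have h1 : blockInner (bcgRun A M B X0 (j + 1)).R (bcgRun A M B X0 j).P = 0 := by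
          rw [← blockInner_transpose, hR j hj, Matrix.transpose_zero]
        have h2 : blockInner (bcgRun A M B X0 j).R (bcgRun A M B X0 j).P =
            (bcgRun A M B X0 j).rho M := by
          rw [← blockInner_transpose, ihρ, rho_transpose hM]
        have h3 : blockInner (bcgRun A M B X0 (j + 1)).R
            (M⁻¹ * (bcgRun A M B X0 (j + 1)).R) = (bcgRun A M B X0 (j + 1)).rho M := by
          rw [← blockInner_mul_comm_of_isHermitian hM.inv.isHermitian, BCGState.rho]
        have hu' := (Matrix.isUnit_iff_isUnit_det _).1 (hk j hj).2
        rw [blockInner_sub_left, blockInner_sub_left, hZ j hj, h1, h2, h3, bcgBeta, sub_zero,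
          ← Matrix.mul_assoc, Matrix.mul_nonsing_inv _ hu', Matrix.one_mul, zero_sub,
          neg_add_cancel]
      · rw [← mul_P_mul_bcgLam j, blockInner_mul_left _ (bcgRun A M B X0 k).P
          (bcgLam_mem A M B X0 j), blockInner_mul_comm_of_isHermitian hA.isHermitian, ihA j hj',
          mul_P_mul_bcgLam, blockInner_sub_left, hZ j hj, hZ (j + 1) (by omega)]
        simp
    · rw [bcgRun_succ_P, blockInner_add_left, blockInner_mul_left _ _ hbeta, hR k k.lt_succ_self,
        Matrix.mul_zero, add_zero]
      rfl

lemma precond_residual_and_P_mem_krylov (k : ℕ) :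
    M⁻¹ * (bcgRun A M B X0 k).R ∈
        krylov (blockGlobal q p) (M⁻¹ * A) (M⁻¹ * (B - A * X0)) (k + 1) ∧
      (bcgRun A M B X0 k).P ∈
        krylov (blockGlobal q p) (M⁻¹ * A) (M⁻¹ * (B - A * X0)) (k + 1) := by
  induction k with
  | zero => exact ⟨self_mem_krylov_one .., self_mem_krylov_one ..⟩
  | succ k ih =>
    let K := krylovSubmodule (blockGlobal q p) (M⁻¹ * A) (M⁻¹ * (B - A * X0)) (k + 1 + 1)
    have hZ : M⁻¹ * (bcgRun A M B X0 (k + 1)).R ∈ K := by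
      rw [bcgRun_succ_R, Matrix.mul_sub, ← Matrix.mul_assoc, ← Matrix.mul_assoc]
      exact K.sub_mem (krylov_mono _ _ _ (Nat.le_succ _) ih.1)
        (mul_coeff_mem_krylov (mul_mem_krylov_succ ih.2) (bcgLam_mem ..))
    refine ⟨hZ, ?_⟩
    rw [bcgRun_succ_P]
    exact K.add_mem hZ (mul_coeff_mem_krylov (krylov_mono _ _ _ (Nat.le_succ _) ih.2)
      (bcgBeta_mem ..))

lemma bcgRun_X_sub_mem_krylov (k : ℕ) : (bcgRun A M B X0 k).X - X0 ∈
    krylov (blockGlobal q p) (M⁻¹ * A) (M⁻¹ * (B - A * X0)) k := by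
  induction k with
  | zero =>
    rw [show (bcgRun A M B X0 0).X = X0 from rfl, sub_self]
    exact (krylovSubmodule _ _ _ _).zero_mem
  | succ k ih =>
    rw [bcgRun_succ_X, add_sub_right_comm]
    exact (krylovSubmodule _ _ _ _).add_mem (krylov_mono _ _ _ (Nat.le_succ _) ih)
      (mul_coeff_mem_krylov (precond_residual_and_P_mem_krylov k).2 (bcgLam_mem ..))

variable (A M B X0) in
/-- The right `S`-module generated by the first `k` search directions, as a real subspace. -/
def directionSpan (k : ℕ) : Submodule ℝ (BlockVec n q p) :=
  Submodule.span ℝ {Y | ∃ j < k, ∃ σ ∈ blockGlobal q p, Y = (bcgRun A M B X0 j).P * σ}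

lemma P_mem_directionSpan {j k : ℕ} (hj : j < k) :
    (bcgRun A M B X0 j).P ∈ directionSpan A M B X0 k :=
  Submodule.subset_span ⟨j, hj, 1, one_mem _, (Matrix.mul_one _).symm⟩

lemma mul_coeff_mem_directionSpan {k : ℕ} {Y : BlockVec n q p}
    (hY : Y ∈ directionSpan A M B X0 k) {σ : Coeff q p} (hσ : σ ∈ blockGlobal q p) :
    Y * σ ∈ directionSpan A M B X0 k := by
  induction hY using Submodule.span_induction with
  | mem Y h =>
    obtain ⟨j, hj, τ, hτ, rfl⟩ := h
    exact Submodule.subset_span ⟨j, hj, τ * σ, mul_mem hτ hσ, Matrix.mul_assoc _ _ _⟩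
  | zero => simp
  | add Y Z _ _ hY hZ => rw [Matrix.add_mul]; exact add_mem hY hZ
  | smul a Y _ hY => rw [Matrix.smul_mul]; exact Submodule.smul_mem _ _ hY

lemma precond_residual_mem_directionSpan {j k : ℕ} (hj : j < k) :
    M⁻¹ * (bcgRun A M B X0 j).R ∈ directionSpan A M B X0 k := by
  rcases j with _ | j
  · exact P_mem_directionSpan hj
  · rw [← add_sub_cancel_right (M⁻¹ * (bcgRun A M B X0 (j + 1)).R)
      ((bcgRun A M B X0 j).P * bcgBeta A M B X0 j), ← bcgRun_succ_P]
    exact sub_mem (P_mem_directionSpan hj)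
      (mul_coeff_mem_directionSpan (P_mem_directionSpan (by omega)) (bcgBeta_mem ..))

lemma mul_mem_directionSpan_succ {k : ℕ} (hk : NoBreakdown A M B X0 k) {Y : BlockVec n q p}
    (hY : Y ∈ directionSpan A M B X0 k) :
    M⁻¹ * A * Y ∈ directionSpan A M B X0 (k + 1) := by
  induction hY using Submodule.span_induction with
  | mem Y h =>
    obtain ⟨j, hj, σ, hσ, rfl⟩ := h
    have hu := (Matrix.isUnit_iff_isUnit_det _).1 (hk.isUnit_bcgLam hj)
    have h : M⁻¹ * A * ((bcgRun A M B X0 j).P * σ) =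
        (M⁻¹ * (bcgRun A M B X0 j).R - M⁻¹ * (bcgRun A M B X0 (j + 1)).R) *
          (bcgLam A M B X0 j)⁻¹ * σ := by
      rw [← Matrix.mul_sub, ← mul_P_mul_bcgLam]
      simp only [Matrix.mul_assoc]
      rw [← Matrix.mul_assoc (bcgLam A M B X0 j), Matrix.mul_nonsing_inv _ hu, Matrix.one_mul]
    rw [h]
    exact mul_coeff_mem_directionSpan (mul_coeff_mem_directionSpan
      (sub_mem (precond_residual_mem_directionSpan (by omega))
        (precond_residual_mem_directionSpan (by omega)))
      (inv_mem_blockGlobal (bcgLam_mem ..))) hσ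
  | zero => simp
  | add Y Z _ _ hY hZ => rw [Matrix.mul_add]; exact add_mem hY hZ
  | smul a Y _ hY => rw [Matrix.mul_smul]; exact Submodule.smul_mem _ _ hY

lemma directionSpan_mono {k l : ℕ} (h : k ≤ l) :
    directionSpan A M B X0 k ≤ directionSpan A M B X0 l :=
  Submodule.span_mono fun _ ⟨j, hj, hσ⟩ => ⟨j, hj.trans_le h, hσ⟩

/-- Without breakdown, the search directions generate the whole Krylov space. -/
lemma krylov_le_directionSpan {k : ℕ} (hk : NoBreakdown A M B X0 k) {Y : BlockVec n q p}
    (hY : Y ∈ krylov (blockGlobal q p) (M⁻¹ * A) (M⁻¹ * (B - A * X0)) k) :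
    Y ∈ directionSpan A M B X0 k := by
  have hpow : ∀ i < k, (M⁻¹ * A) ^ i * (M⁻¹ * (B - A * X0)) ∈
      directionSpan A M B X0 (i + 1) := by
    intro i
    induction i with
    | zero =>
      intro _
      rw [pow_zero, Matrix.one_mul]
      exact P_mem_directionSpan (j := 0) zero_lt_one
    | succ i ih =>
      intro hi
      rw [pow_succ', Matrix.mul_assoc]
      exact mul_mem_directionSpan_succ (fun j hj => hk j (by omega)) (ih (by omega))
  obtain ⟨c, hc, rfl⟩ := hY
  refine sum_mem fun i hi => mul_coeff_mem_directionSpan ?_ (hc i)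
  have hi' := Finset.mem_range.1 hi
  exact directionSpan_mono hi' (hpow i hi')

/-- Without breakdown, the algorithm computes the energy minimizer over the affine Krylov space. -/
lemma isBCGIterate_bcgRun (hq : 0 < q) (hA : A.PosDef) (hM : M.PosDef) {Xstar : BlockVec n q p}
    (hX : A * Xstar = B) {k : ℕ} (hk : NoBreakdown A M B X0 k) :
    IsBCGIterate (blockGlobal q p) A M B X0 k (bcgRun A M B X0 k).X := by
  refine (isBCGIterate_of_orthogonal hA hX (bcgRun_X_sub_mem_krylov k) fun Z hZ => ?_).1
  have h : blockInner Z (bcgRun A M B X0 k).R = 0 := by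
    have hZ' := krylov_le_directionSpan hk hZ
    clear hZ
    induction hZ' using Submodule.span_induction with
    | mem Y h =>
      obtain ⟨j, hj, σ, hσ, rfl⟩ := h
      rw [blockInner_mul_left _ _ hσ, (bcgRun_orthogonality hA hM k hk).1 j hj, Matrix.mul_zero]
    | zero => exact blockInner_zero_left _
    | add Y Z _ _ hY hZ => rw [blockInner_add_left, hY, hZ, add_zero]
    | smul a Y _ hY => rw [blockInner_smul_left, hY, smul_zero]
  rw [energyForm_apply, Matrix.mul_assoc, Matrix.mul_sub, hX, ← bcgRun_R, ← trace_blockInner hq, h,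
    Matrix.trace_zero]

end Run

end BlockKrylov

/-! ### The convergence rate -/

theorem lemma4p6 (p q r : ℕ) (hp : 0 < p) (hq : 0 < q) (hr : r = ⌈(p : ℚ) / (q : ℚ)⌉₊) :
    ∃ C : ℝ → ℝ → ℝ → ℝ, (∀ a b d, 0 < C a b d) ∧
      ∀ (n : ℕ) (A M : Matrix (Fin n) (Fin n) ℝ), A.PosDef → M.PosDef →
      ∀ ev : ℕ → ℝ, IsOrderedSpectrum (precond A M) ev →
      r ≤ n → (1 < r → ev r < ev n) →
      ∀ B X0 Xstar : BlockVec n q p, A * Xstar = B →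
        (∀ k : ℕ, ∃! Y, IsBCGIterate (blockGlobal q p) A M B X0 k Y) ∧
        (∀ (k : ℕ) (Y : BlockVec n q p), IsBCGIterate (blockGlobal q p) A M B X0 k Y →
          ∀ i : Fin q × Fin p,
            energyNorm A ((Xstar - Y).col i) ≤
              C (ev 1) (ev r) (ev n) * blockEnergyNorm A (Xstar - X0) *
                cgRate (ev n / ev r) ^ k) ∧
        (∀ k : ℕ, (∀ j < k, IsUnit ((bcgRun A M B X0 j).alpha A) ∧
              IsUnit ((bcgRun A M B X0 j).rho M)) →
          ∀ i : Fin q × Fin p,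
            energyNorm A ((Xstar - (bcgRun A M B X0 k).X).col i) ≤
              C (ev 1) (ev r) (ev n) * blockEnergyNorm A (Xstar - X0) *
                cgRate (ev n / ev r) ^ k) := by
  have hr1 : 1 ≤ r := by
    rw [hr]
    exact Nat.one_le_ceil_iff.2 (by positivity)
  refine ⟨deflationConst (r - 1), deflationConst_pos _, fun n A M hA hM ev hev hrn hlt B X0 Xstar
    hX => ?_⟩
  have hpos := hev.pos (precond_posDef hA hM)
  have bound : ∀ (k : ℕ) (Y : BlockVec n q p), IsBCGIterate (blockGlobal q p) A M B X0 k Y →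
      ∀ i : Fin q × Fin p, energyNorm A ((Xstar - Y).col i) ≤
        deflationConst (r - 1) (ev 1) (ev r) (ev n) * blockEnergyNorm A (Xstar - X0) *
          cgRate (ev n / ev r) ^ k := by
    intro k Y hY i
    obtain ⟨f, hd, h0, hf⟩ := exists_deflated_polynomial hev.1 hpos hr1 hrn hlt k
    have hc : 0 ≤ deflationConst (r - 1) (ev 1) (ev r) (ev n) * cgRate (ev n / ev r) ^ k :=
      (abs_nonneg _).trans (hf n ⟨hr1.trans hrn, le_rfl⟩)
    refine (energyNorm_col_le hA _ i).trans
      ((hY.blockEnergyNorm_le hA hM hX hd h0 hc fun x hx => ?_).trans_eq (by ring))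
    obtain ⟨j, hj, rfl⟩ := hev.exists_eq_of_mem_spectrum hx
    exact hf j hj
  exact ⟨fun k => existsUnique_isBCGIterate _ M hA X0 hX k, bound,
    fun k hk => bound k _ (isBCGIterate_bcgRun hq hA hM hX hk)⟩
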